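/- Let $k\ge 3$ and $m\ge 9$ be integers and put $n=mk(k-1)$. For a finite $k$-uniform hypergraph $G$ (a finite vertex set $V$ with a set $E$ of $k$-element subsets of $V$, called edges), let $\rho(G)$ be the spectral radius of its adjacency tensor $\mathcal A(G)=(a_{i_1\cdots i_k})_{i_1,\dots,i_k\in V}$, where $a_{i_1\cdots i_k}=\frac1{(k-1)!}$ if $\{i_1,\dots,i_k\}\in E$ and $a_{i_1\cdots i_k}=0$ otherwise; that is, $\rho(G)$ is the largest modulus of a number $\lambda\in\mathbb C$ for which some nonzero $x\in\mathbb C^V$ satisfies $$\sum_{i_2,\dots,i_k\in V}a_{i\,i_2\cdots i_k}\,x_{i_2}\cdots x_{i_k}=\lambda x_i^{k-1}\qquad\text{for all } i\in V.$$ Let $C_3=v_1e_1v_2e_2v_3e_3v_1$ be the $k$-uniform cycle of length $3$: its edges are $e_1=\{v_1,v_2\}\cup W_1$, $e_2=\{v_2,v_3\}\cup W_2$, $e_3=\{v_3,v_1\}\cup W_3$, where $W_1,W_2,W_3$ are pairwise disjoint sets of $k-2$ further vertices each. For $a\ge 1$ let $C_3(v_1,u_0)S_{a,k}$ be obtained from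 $C_3$ by adding $a$ edges, each consisting of $v_1$ and $k-1$ new vertices. Attaching a pendent edge at a vertex $v$ means adding an edge that consists of $v$ and $k-1$ new vertices. Let $A_{n,k}$ be obtained from $C_3(v_1,u_0)S_{m-3,k}$ by attaching one pendent edge at each of its vertices, and let $D_{n,k}$ be obtained from $C_3(v_1,u_0)S_{m-2,k}$ by attaching one pendent edge at each of its vertices that does not belong to $e_2$. (Both hypergraphs are $k$-uniform with $n$ vertices.) Then $$\rho(D_{n,k})>\rho(A_{n,k}).$$ -/

import Mathlib

/-- A real tensor (hypermatrix) of order `r + 1` whose indices run over `ι`, given by its entries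
`a_{i₁ i₂ … i_{r+1}}`. -/
def Hypermatrix (r : ℕ) (ι : Type*) : Type _ := (Fin (r + 1) → ι) → ℝ

namespace Hypermatrix

variable {r : ℕ} {ι : Type*} [Fintype ι]

/-- The vector `𝒜x` with `(𝒜x)_i = ∑_{i₂, …, i_{r+1}} a_{i i₂ … i_{r+1}} x_{i₂} ⋯ x_{i_{r+1}}`. -/
noncomputable def apply (T : Hypermatrix r ι) (x : ι → ℂ) : ι → ℂ := fun i =>
  ∑ j : Fin r → ι, (T (Fin.cons i j) : ℂ) * ∏ t, x (j t)

/-- `μ ∈ ℂ` is an eigenvalue of a tensor of order `r + 1` if some nonzero `x ∈ ℂ^ι` satisfies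
`(𝒜x)_i = μ x_i ^ r` for all `i`. -/
def IsEigenvalue (T : Hypermatrix r ι) (μ : ℂ) : Prop :=
  ∃ x : ι → ℂ, x ≠ 0 ∧ ∀ i, T.apply x i = μ * x i ^ r

/-- The spectral radius: the largest modulus of an eigenvalue. The supremum is attained as soon as
there is an eigenvalue, see `isGreatest_spectralRadius`. -/
noncomputable def spectralRadius (T : Hypermatrix r ι) : ℝ :=
  sSup {ρ : ℝ | ∃ μ : ℂ, T.IsEigenvalue μ ∧ ρ = ‖μ‖}

theorem apply_smul (T : Hypermatrix r ι) (c : ℂ) (x : ι → ℂ) (i : ι) :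
    T.apply (c • x) i = c ^ r * T.apply x i := by
  simp only [apply, Pi.smul_apply, smul_eq_mul, Finset.prod_mul_distrib, Finset.prod_const,
    Finset.card_univ, Fintype.card_fin, Finset.mul_sum]
  exact Finset.sum_congr rfl fun j _ => by ring

theorem isGreatest_spectralRadius (T : Hypermatrix r ι) (h : ∃ μ, T.IsEigenvalue μ) :
    IsGreatest {ρ : ℝ | ∃ μ : ℂ, T.IsEigenvalue μ ∧ ρ = ‖μ‖} T.spectralRadius := by
  classical
  set C : ℝ := ∑ i : ι, ∑ j : Fin r → ι, |T (Fin.cons i j)| with hC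
  set K : Set (ℂ × (ι → ℂ)) :=
    (Metric.closedBall 0 C ×ˢ Metric.sphere 0 1) ∩ ⋂ i, {p | T.apply p.2 i = p.1 * p.2 i ^ r}
    with hK
  have hKc : IsCompact K := by
    refine ((isCompact_closedBall _ _).prod (isCompact_sphere _ _)).inter_right ?_
    refine isClosed_iInter fun i => isClosed_eq ?_ ?_
    · unfold apply
      fun_prop
    · fun_prop
  have hset : {ρ : ℝ | ∃ μ : ℂ, T.IsEigenvalue μ ∧ ρ = ‖μ‖} = (fun p => ‖p.1‖) '' K := by
    ext ρ
    constructor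
    · rintro ⟨μ, ⟨x, hx, hμ⟩, rfl⟩
      have hn : ‖x‖ ≠ 0 := norm_ne_zero_iff.2 hx
      set y : ι → ℂ := ((‖x‖ : ℂ)⁻¹) • x with hy
      have hy1 : ‖y‖ = 1 := by
        rw [hy, norm_smul, norm_inv, Complex.norm_real, norm_norm, inv_mul_cancel₀ hn]
      have hyμ : ∀ i, T.apply y i = μ * y i ^ r := fun i => by
        rw [hy, apply_smul, hμ, Pi.smul_apply, smul_eq_mul]
        ring
      refine ⟨(μ, y), ⟨⟨?_, by simpa using hy1⟩, Set.mem_iInter.2 hyμ⟩, rfl⟩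
      have hne : Nonempty ι := by
        by_contra hne
        rw [not_nonempty_iff] at hne
        exact hx (Subsingleton.elim _ _)
      obtain ⟨i, hi⟩ : ∃ i, ‖y i‖ = 1 := by
        obtain ⟨i, hi⟩ := Finite.exists_max fun i => ‖y i‖
        refine ⟨i, le_antisymm (hy1 ▸ norm_le_pi_norm y i) ?_⟩
        exact hy1 ▸ (pi_norm_le_iff_of_nonneg (norm_nonneg _)).2 hi
      have h1 : ‖μ‖ = ‖T.apply y i‖ := by rw [hyμ, norm_mul, norm_pow, hi]; simp
      have h2 : ‖T.apply y i‖ ≤ ∑ j : Fin r → ι, |T (Fin.cons i j)| := by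
        refine norm_sum_le_of_le _ fun j _ => ?_
        rw [norm_mul, Complex.norm_real, norm_prod, Real.norm_eq_abs]
        refine mul_le_of_le_one_right (abs_nonneg _) ?_
        exact Finset.prod_le_one (fun _ _ => norm_nonneg _)
          fun t _ => hy1 ▸ norm_le_pi_norm y (j t)
      have h3 : ∑ j : Fin r → ι, |T (Fin.cons i j)| ≤ C :=
        Finset.single_le_sum (f := fun i => ∑ j : Fin r → ι, |T (Fin.cons i j)|)
          (fun _ _ => Finset.sum_nonneg fun _ _ => abs_nonneg _) (Finset.mem_univ i)
      simpa using h1.le.trans (h2.trans h3)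
    · rintro ⟨⟨μ, x⟩, ⟨⟨-, hx⟩, hμ⟩, rfl⟩
      refine ⟨μ, ⟨x, ?_, Set.mem_iInter.1 hμ⟩, rfl⟩
      rintro rfl
      simp at hx
  have hne : K.Nonempty := by
    obtain ⟨μ, hμ⟩ := h
    have : (‖μ‖ : ℝ) ∈ (fun p : ℂ × (ι → ℂ) => ‖p.1‖) '' K := hset ▸ ⟨μ, hμ, rfl⟩
    exact Set.image_nonempty.1 ⟨_, this⟩
  rw [spectralRadius, hset]
  exact (hKc.image (by fun_prop)).isGreatest_sSup (hne.image _)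

end Hypermatrix

namespace Hypergraph

variable {α β : Type*}

/-- The adjacency tensor, of order `k = (k - 1) + 1`, of a `k`-uniform hypergraph (`k ≥ 1`): its
`(i₁, …, i_k)` entry is `1 / (k - 1)!` if `{i₁, …, i_k}` is an edge and `0` otherwise. -/
noncomputable def adjacencyTensor (k : ℕ) (H : Hypergraph α) : Hypermatrix (k - 1) V(H) :=
  open Classical in
  fun i => if Set.range (fun t => (i t : α)) ∈ E(H) then 1 / ((k - 1).factorial : ℝ) else 0

/-- The spectral radius `ρ(H)` of a finite `k`-uniform hypergraph. -/
noncomputable def spectralRadius (k : ℕ) (H : Hypergraph α) [Finite V(H)] : ℝ :=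
  letI : Fintype V(H) := Fintype.ofFinite _
  (H.adjacencyTensor k).spectralRadius

/-- A nonempty finite `k`-uniform hypergraph with `k ≥ 3` has an eigenvalue, so that
`H.spectralRadius k` is the maximum of the moduli of the eigenvalues. -/
theorem exists_isEigenvalue (k : ℕ) (hk : 3 ≤ k) (H : Hypergraph α) [Fintype V(H)]
    (hne : V(H).Nonempty) (hH : ∀ e ∈ E(H), e.ncard = k) :
    ∃ μ, (H.adjacencyTensor k).IsEigenvalue μ := by
  classical
  obtain ⟨v, hv⟩ := hne
  refine ⟨0, Pi.single ⟨v, hv⟩ 1, fun h => ?_, fun i => ?_⟩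
  · simpa using congrFun h ⟨v, hv⟩
  rw [zero_mul]
  refine Finset.sum_eq_zero fun j _ => ?_
  by_cases hj : ∀ t, j t = ⟨v, hv⟩
  · have hsub : Set.range (fun t => ((Fin.cons i j : Fin (k - 1 + 1) → V(H)) t : α)) ⊆
        {(i : α), v} := by
      rintro _ ⟨t, rfl⟩
      refine Fin.cases ?_ (fun t => ?_) t
      · simp
      · simp [hj]
    have hnot : Set.range (fun t => ((Fin.cons i j : Fin (k - 1 + 1) → V(H)) t : α)) ∉ E(H) := by
      intro he
      have h1 := Set.ncard_le_ncard hsub (by simp)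
      have h2 := Set.ncard_insert_le (i : α) {v}
      rw [Set.ncard_singleton] at h2
      have := hH _ he
      omega
    simp [adjacencyTensor, hnot]
  · push Not at hj
    obtain ⟨t, ht⟩ := hj
    rw [Finset.prod_eq_zero (Finset.mem_univ t) (by simp [ht]), mul_zero]

/-- The `i`-th edge of the `k`-uniform cycle of length 3: it consists of `v_i`, `v_{i+1}`
(indices mod 3) and `k - 2` further vertices. With `i = 0, 1, 2` for 1, 2, 3 these are
`e₁ ∋ v₁, v₂`, `e₂ ∋ v₂, v₃` and `e₃ ∋ v₃, v₁`. -/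
def triangleEdge (k : ℕ) (i : Fin 3) : Set (Fin 3 ⊕ Fin 3 × Fin (k - 2)) :=
  {Sum.inl i, Sum.inl (i + 1)} ∪ Set.range fun j => Sum.inr (i, j)

/-- The `k`-uniform cycle `C₃ = v₁ e₁ v₂ e₂ v₃ e₃ v₁` of length 3. -/
def triangle (k : ℕ) : Hypergraph (Fin 3 ⊕ Fin 3 × Fin (k - 2)) where
  vertexSet := Set.univ
  edgeSet := Set.range (triangleEdge k)
  subset_vertexSet_of_mem_edgeSet' _ _ := Set.subset_univ _

/-- The `k`-uniform star `S_{a,k}`: `a` edges with `k` vertices each, any two of which meet exactly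
in the center `u₀ = none`. -/
def star (a k : ℕ) : Hypergraph (Option (Fin a × Fin (k - 1))) where
  vertexSet := Set.univ
  edgeSet := Set.range fun i : Fin a => insert none (Set.range fun j => some (i, j))
  subset_vertexSet_of_mem_edgeSet' _ _ := Set.subset_univ _

/-- The map of the vertices of the second hypergraph into the coalescence, sending `w` to `v`. -/
noncomputable def glue (v : α) (w : β) : β → α ⊕ β :=
  open Classical in fun b => if b = w then Sum.inl v else Sum.inr b

/-- `G(v, w)H`: the disjoint union of `G` and `H` with the vertices `v` of `G` and `w` of `H`
identified. -/
noncomputable def coalesce (G : Hypergraph α) (v : α) (H : Hypergraph β) (w : β) :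
    Hypergraph (α ⊕ β) where
  vertexSet := V(G.image Sum.inl) ∪ V(H.image (glue v w))
  edgeSet := E(G.image Sum.inl) ∪ E(H.image (glue v w))
  subset_vertexSet_of_mem_edgeSet' _ he := he.elim
    (fun h => (subset_vertexSet_of_mem_edgeSet h).trans Set.subset_union_left)
    (fun h => (subset_vertexSet_of_mem_edgeSet h).trans Set.subset_union_right)

/-- The new edge at `s`: it consists of `s` and `k - 1` new vertices. -/
def newPendentEdge (k : ℕ) (s : α) : Set (α ⊕ α × Fin (k - 1)) :=
  insert (Sum.inl s) (Set.range fun j => Sum.inr (s, j))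

/-- The hypergraph obtained from `H` by attaching one pendent edge with `k` vertices at each vertex
in `S`. -/
def attachPendentEdges (k : ℕ) (H : Hypergraph α) (S : Set α) (hS : S ⊆ V(H)) :
    Hypergraph (α ⊕ α × Fin (k - 1)) where
  vertexSet := Sum.inl '' V(H) ∪ {p | ∃ s ∈ S, ∃ j, p = Sum.inr (s, j)}
  edgeSet := (Set.image Sum.inl) '' E(H) ∪ newPendentEdge k '' S
  subset_vertexSet_of_mem_edgeSet' := by
    rintro e (⟨e, he, rfl⟩ | ⟨s, hs, rfl⟩)
    · exact (Set.image_mono (subset_vertexSet_of_mem_edgeSet he)).trans Set.subset_union_left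
    · rintro p (rfl | ⟨j, rfl⟩)
      · exact Or.inl ⟨s, hS hs, rfl⟩
      · exact Or.inr ⟨s, hs, j, rfl⟩

/-- `C₃(v₁, u₀)S_{a,k}`: the cycle of length 3 and the star with `a` edges, glued at `v₁ = u₀`. -/
noncomputable def triangleStar (a k : ℕ) :
    Hypergraph ((Fin 3 ⊕ Fin 3 × Fin (k - 2)) ⊕ Option (Fin a × Fin (k - 1))) :=
  (triangle k).coalesce (Sum.inl 0) (star a k) none

/-- `A_{n,k}` with `n = m k (k - 1)` and `m, k ≥ 3`: one pendent edge is attached at each vertex of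
`C₃(v₁, u₀)S_{m-3,k}`. -/
noncomputable def hypergraphA (m k : ℕ) :
    Hypergraph
      (((Fin 3 ⊕ Fin 3 × Fin (k - 2)) ⊕ Option (Fin (m - 3) × Fin (k - 1))) ⊕
        ((Fin 3 ⊕ Fin 3 × Fin (k - 2)) ⊕ Option (Fin (m - 3) × Fin (k - 1))) × Fin (k - 1)) :=
  (triangleStar (m - 3) k).attachPendentEdges k V(triangleStar (m - 3) k) subset_rfl

/-- `D_{n,k}` with `n = m k (k - 1)`, `m ≥ 2` and `k ≥ 3`: one pendent edge is attached at each
vertex of `C₃(v₁, u₀)S_{m-2,k}` that is not incident with `e₂` (the edge of the cycle that avoids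
`v₁`). -/
noncomputable def hypergraphD (m k : ℕ) :
    Hypergraph
      (((Fin 3 ⊕ Fin 3 × Fin (k - 2)) ⊕ Option (Fin (m - 2) × Fin (k - 1))) ⊕
        ((Fin 3 ⊕ Fin 3 × Fin (k - 2)) ⊕ Option (Fin (m - 2) × Fin (k - 1))) × Fin (k - 1)) :=
  (triangleStar (m - 2) k).attachPendentEdges k
    (V(triangleStar (m - 2) k) \ Sum.inl '' triangleEdge k 1) Set.sdiff_subset

end Hypergraph

/-!
The spectral radius of a nonnegative tensor with a positive eigenvector is the eigenvalue of that
eigenvector (`Hypermatrix.spectralRadius_eq_of_apply_eq`), so each of the two spectral radii is found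
by exhibiting a positive eigenvector. The eigenvalue equations are made rational by passing to
labels: `q v` stands for `x v ^ k`, `p e` for the product of `x` over the edge `e` divided by `λ`, and
`t` for `λ ^ (-k)`. Then `x` is an eigenvector if and only if `t * ∏ v ∈ e, q v = p e ^ k` for each
edge and the labels of the edges at `v` add up to `q v` (`Hypergraph.spectralRadius_eq_of_labelling`).
A pendent edge at `v` and its new vertices then get the label `t * q v`, so that the other edges at
`v` have to add up to `(1 - t) * q v`.

Write `s ^ 2 = t / (1 - t) ^ k`, and normalize the label of the center `v₁` to `1`. By symmetry all
the labels are determined by `t`, and the equation at the center is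
`s ^ 2 * (m - 3 + 2 / (1 - s)) = 1` for `A` and `s ^ 2 * (m - 2 + 2 * (1 + √t)) = 1` for `D`.
For `m ≥ 9` the solution of the first one has `s ≤ 1 / 3`, hence `2 / (1 - s) ≤ 3 < 3 + 2 * √t`.
At the parameter `t` of `A`, the left-hand side for `D` therefore exceeds `1`, and by the
intermediate value theorem the equation for `D` has a smaller solution `t`. As `λ = t ^ (-1 / k)`,
the spectral radius of `D` is larger.
-/

/-! ### Positive eigenvectors of nonnegative tensors -/

namespace Hypermatrix

variable {r : ℕ} {ι : Type*} [Fintype ι]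

/-- A positive eigenvector of a nonnegative tensor belongs to an eigenvalue of largest modulus: for
any other eigenvector `y`, compare both sides of its equation at an index maximizing
`‖y i‖ / x i`. -/
theorem norm_le_of_isEigenvalue {T : Hypermatrix r ι} (hT : ∀ i, 0 ≤ T i) {x : ι → ℝ}
    (hx : ∀ i, 0 < x i) {ρ : ℝ} (hρ : ∀ i, T.apply (fun v => (x v : ℂ)) i = ρ * (x i : ℂ) ^ r)
    {μ : ℂ} (hμ : T.IsEigenvalue μ) : ‖μ‖ ≤ ρ := by
  obtain ⟨y, hy, hyμ⟩ := hμ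
  obtain ⟨w, hw⟩ := Function.ne_iff.1 hy
  have : Nonempty ι := ⟨w⟩
  obtain ⟨i, hi⟩ := Finite.exists_max fun i => ‖y i‖ / x i
  set M := ‖y i‖ / x i with hM
  have hle : ∀ j, ‖y j‖ ≤ M * x j := fun j => (div_le_iff₀ (hx j)).1 (hi j)
  have hMpos : 0 < M := (div_pos (norm_pos_iff.2 hw) (hx w)).trans_le (hi w)
  have hyi : ‖y i‖ = M * x i := by rw [hM, div_mul_cancel₀ _ (hx i).ne']
  have hreal : ∑ j : Fin r → ι, T (Fin.cons i j) * ∏ t, x (j t) = ρ * x i ^ r := by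
    have h := hρ i
    simp only [apply] at h
    exact_mod_cast h
  have key : ‖μ‖ * ‖y i‖ ^ r ≤ ρ * ‖y i‖ ^ r := by
    calc ‖μ‖ * ‖y i‖ ^ r = ‖T.apply y i‖ := by rw [hyμ, norm_mul, norm_pow]
      _ ≤ ∑ j : Fin r → ι, T (Fin.cons i j) * ∏ t, (M * x (j t)) := by
        refine norm_sum_le_of_le _ fun j _ => ?_
        rw [norm_mul, Complex.norm_real, norm_prod, Real.norm_of_nonneg (hT _)]
        exact mul_le_mul_of_nonneg_left
          (Finset.prod_le_prod (fun _ _ => norm_nonneg _) fun t _ => hle (j t)) (hT _)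
      _ = M ^ r * ∑ j : Fin r → ι, T (Fin.cons i j) * ∏ t, x (j t) := by
        rw [Finset.mul_sum]
        refine Finset.sum_congr rfl fun j _ => ?_
        rw [Finset.prod_mul_distrib, Finset.prod_const, Finset.card_univ, Fintype.card_fin]
        ring
      _ = ρ * ‖y i‖ ^ r := by rw [hreal, hyi]; ring
  exact le_of_mul_le_mul_right key (pow_pos (hyi ▸ mul_pos hMpos (hx i)) r)

theorem spectralRadius_eq_of_apply_eq [Nonempty ι] {T : Hypermatrix r ι} (hT : ∀ i, 0 ≤ T i)
    {x : ι → ℝ} (hx : ∀ i, 0 < x i) {ρ : ℝ} (hρ0 : 0 ≤ ρ)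
    (hρ : ∀ i, T.apply (fun v => (x v : ℂ)) i = ρ * (x i : ℂ) ^ r) : T.spectralRadius = ρ := by
  have hev : T.IsEigenvalue (ρ : ℂ) := by
    refine ⟨fun v => (x v : ℂ), fun h => ?_, hρ⟩
    obtain ⟨i⟩ := ‹Nonempty ι›
    exact (hx i).ne' (by simpa using congrFun h i)
  refine IsGreatest.csSup_eq ⟨⟨ρ, hev, ?_⟩, ?_⟩
  · rw [Complex.norm_real, Real.norm_of_nonneg hρ0]
  · rintro _ ⟨μ, hμ, rfl⟩
    exact norm_le_of_isEigenvalue hT hx hρ hμ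

end Hypermatrix

/-! ### Spectral radius from a labelling of vertices and edges -/

/-- A finite set of size `r` is enumerated by `r!` sequences of length `r`. -/
theorem card_filter_image_val_eq {α : Type*} [DecidableEq α] {V : Set α} [Fintype V] {r : ℕ}
    {s : Finset α} (hsV : (s : Set α) ⊆ V) (hs : s.card = r) :
    (Finset.univ.filter fun j : Fin r → V =>
      Finset.univ.image (fun t => (j t : α)) = s).card = r.factorial := by
  let φ : (Fin r ≃ s) → Fin r → V := fun σ t => ⟨σ t, hsV (σ t).2⟩
  have hφ : Function.Injective φ := fun σ τ h => by
    ext t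
    exact congrArg (fun v : V => (v : α)) (congrFun h t)
  have himage : (Finset.univ.filter fun j : Fin r → V =>
      Finset.univ.image (fun t => (j t : α)) = s) = Finset.univ.image φ := by
    ext j
    simp only [Finset.mem_filter, Finset.mem_univ, true_and, Finset.mem_image]
    constructor
    · intro hj
      have hmem : ∀ t, (j t : α) ∈ s := fun t =>
        hj ▸ Finset.mem_image_of_mem (fun t => (j t : α)) (Finset.mem_univ t)
      have hinj : Function.Injective fun t => (j t : α) := by
        rw [← Set.injOn_univ, ← Finset.coe_univ, ← Finset.card_image_iff, hj, hs,
          Finset.card_univ, Fintype.card_fin]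
      have hbij : Function.Bijective fun t => (⟨j t, hmem t⟩ : s) :=
        (Fintype.bijective_iff_injective_and_card _).2
          ⟨fun a b hab => hinj (congrArg (fun v : s => (v : α)) hab), by simp [hs]⟩
      exact ⟨Equiv.ofBijective _ hbij, rfl⟩
    · rintro ⟨σ, rfl⟩
      ext a
      simp only [Finset.mem_image, Finset.mem_univ, true_and, φ]
      exact ⟨fun ⟨t, ht⟩ => ht ▸ (σ t).2, fun ha => ⟨σ.symm ⟨a, ha⟩, by simp⟩⟩
  rw [himage, Finset.card_image_of_injective _ hφ, Finset.card_univ,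
    Fintype.card_equiv (Fintype.equivFinOfCardEq (by simp [hs])).symm, Fintype.card_fin]

namespace Hypergraph

/-- The family `edge` lists each edge of the `k`-uniform hypergraph `H` exactly once. -/
structure IsEdgeFamily {α I : Type*} (k : ℕ) (H : Hypergraph α) (edge : I → Finset α) : Prop where
  injective : Function.Injective edge
  card_eq : ∀ e, (edge e).card = k
  edgeSet_eq : E(H) = Set.range fun e => (edge e : Set α)

/-- The factor `1 / (k - 1)!` of the adjacency tensor cancels the number of orderings of the other
`k - 1` vertices of an edge at `i`. -/
theorem adjacencyTensor_apply {α I : Type*} [DecidableEq α] [Fintype I] {k : ℕ}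
    {H : Hypergraph α} [Fintype V(H)] {edge : I → Finset α} (hH : H.IsEdgeFamily k edge)
    (x : α → ℂ) (i : V(H)) :
    (H.adjacencyTensor k).apply (fun v => x v) i =
      ∑ e, if (i : α) ∈ edge e then ∏ w ∈ (edge e).erase i, x w else 0 := by
  classical
  have hsub : ∀ e, (edge e : Set α) ⊆ V(H) := fun e =>
    subset_vertexSet_of_mem_edgeSet (hH.edgeSet_eq ▸ ⟨e, rfl⟩)
  have hcard : ∀ e, (i : α) ∈ edge e → ((edge e).erase i).card = k - 1 := fun e he => by
    rw [Finset.card_erase_of_mem he, hH.card_eq]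
  have hrange : ∀ j : Fin (k - 1) → V(H),
      Set.range (fun t => ((Fin.cons i j : Fin (k - 1 + 1) → V(H)) t : α)) =
        ((insert (i : α) (Finset.univ.image fun t => (j t : α)) : Finset α) : Set α) := by
    intro j
    ext a
    simp [Fin.exists_fin_succ, eq_comm]
  -- If `i` and `k - 1` further entries fill an edge with `k` vertices, these entries avoid `i`.
  have hiff : ∀ (j : Fin (k - 1) → V(H)) e,
      insert (i : α) (Finset.univ.image fun t => (j t : α)) = edge e ↔
        (i : α) ∈ edge e ∧ Finset.univ.image (fun t => (j t : α)) = (edge e).erase i := by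
    intro j e
    constructor
    · intro h
      have hi : (i : α) ∈ edge e := h ▸ Finset.mem_insert_self _ _
      refine ⟨hi, (Finset.eq_of_subset_of_card_le ?_ ?_).symm⟩
      · rw [← h]
        exact Finset.erase_insert_subset _ _
      · rw [hcard e hi]
        exact Finset.card_image_le.trans (by simp)
    · rintro ⟨hi, h⟩
      rw [h, Finset.insert_erase hi]
  have hentry : ∀ j : Fin (k - 1) → V(H), H.adjacencyTensor k (Fin.cons i j) =
      ∑ e, if (i : α) ∈ edge e ∧ Finset.univ.image (fun t => (j t : α)) = (edge e).erase i
        then 1 / ((k - 1).factorial : ℝ) else 0 := by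
    intro j
    simp only [adjacencyTensor, hrange, ← hiff, hH.edgeSet_eq, Set.mem_range, Finset.coe_inj]
    split_ifs with h
    · obtain ⟨e, he⟩ := h
      rw [← he, Finset.sum_eq_single_of_mem e (Finset.mem_univ e)]
      · rw [if_pos rfl]
      · exact fun b _ hb => if_neg fun h => hb (hH.injective h.symm)
    · exact (Finset.sum_eq_zero fun e _ => if_neg fun h' => h ⟨e, h'.symm⟩).symm
  simp only [Hypermatrix.apply, hentry, Complex.ofReal_sum, Finset.sum_mul]
  rw [Finset.sum_comm]
  refine Finset.sum_congr rfl fun e _ => ?_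
  split_ifs with hi
  · simp only [hi, true_and]
    have hterm : ∀ j : Fin (k - 1) → V(H),
        (((if Finset.univ.image (fun t => (j t : α)) = (edge e).erase i
          then 1 / ((k - 1).factorial : ℝ) else 0 : ℝ) : ℂ) * ∏ t, x (j t)) =
        if Finset.univ.image (fun t => (j t : α)) = (edge e).erase i
          then 1 / ((k - 1).factorial : ℂ) * ∏ w ∈ (edge e).erase i, x w else 0 := by
      intro j
      split_ifs with h
      · have hinj : Set.InjOn (fun t => (j t : α)) (Finset.univ : Finset (Fin (k - 1))) := by
          rw [← Finset.card_image_iff, h, hcard e hi, Finset.card_univ, Fintype.card_fin]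
        rw [← h, Finset.prod_image hinj]
        push_cast
        rfl
      · simp
    rw [Finset.sum_congr rfl fun j _ => hterm j, ← Finset.sum_filter, Finset.sum_const,
      card_filter_image_val_eq ?_ (hcard e hi), nsmul_eq_mul, ← mul_assoc,
      mul_one_div_cancel (Nat.cast_ne_zero.2 (Nat.factorial_ne_zero _)), one_mul]
    exact (Finset.coe_subset.2 (Finset.erase_subset _ _)).trans (hsub e)
  · simp [hi]

/-- Positive labels `q` on the vertices and `p` on the edges of a `k`-uniform hypergraph such that
`t * ∏ v ∈ e, q v = p e ^ k` for every edge `e`, and the labels of the edges at a vertex `v ∈ V` sum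
to `f v * q v`. With `f = 1` and `λ = t ^ (-1 / k)` this says that `x v = q v ^ (1 / k)` is an
eigenvector of the adjacency tensor for the eigenvalue `λ`, and `∏ v ∈ e, x v = λ * p e`. A factor
`f v < 1` leaves room for further edges at `v`. -/
structure IsConsistentLabelling {α I : Type*} [DecidableEq α] [Fintype I] (k : ℕ) (V : Set α)
    (edge : I → Finset α) (t : ℝ) (f q : α → ℝ) (p : I → ℝ) : Prop where
  vertex_pos : ∀ v, 0 < q v
  edge_pos : ∀ e, 0 < p e
  mul_prod_eq : ∀ e, t * ∏ v ∈ edge e, q v = p e ^ k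
  sum_eq : ∀ v ∈ V, (∑ e, if v ∈ edge e then p e else 0) = f v * q v

theorem spectralRadius_eq_of_labelling {α I : Type*} [DecidableEq α] [Fintype I] {k : ℕ}
    (hk : 1 ≤ k) {H : Hypergraph α} [Finite V(H)] (hV : V(H).Nonempty) {edge : I → Finset α}
    (hH : H.IsEdgeFamily k edge) {t : ℝ} (ht : 0 < t) {q : α → ℝ} {p : I → ℝ}
    (h : IsConsistentLabelling k V(H) edge t (fun _ => 1) q p) :
    H.spectralRadius k = t⁻¹ ^ (k⁻¹ : ℝ) := by
  let : Fintype V(H) := Fintype.ofFinite _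
  have : Nonempty V(H) := hV.to_subtype
  have hk0 : k ≠ 0 := by omega
  set x : α → ℝ := fun v => q v ^ (k⁻¹ : ℝ) with hx
  have hxpos : ∀ v, 0 < x v := fun v => Real.rpow_pos_of_pos (h.vertex_pos v) _
  have hxk : ∀ v, x v ^ k = q v := fun v => Real.rpow_inv_natCast_pow (h.vertex_pos v).le hk0
  have hprod : ∀ e, ∏ v ∈ edge e, x v = t⁻¹ ^ (k⁻¹ : ℝ) * p e := by
    intro e
    have hpe : p e = (p e ^ k) ^ (k⁻¹ : ℝ) := (Real.pow_rpow_inv_natCast (h.edge_pos e).le hk0).symm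
    rw [hpe, ← h.mul_prod_eq, ← Real.mul_rpow (inv_pos.2 ht).le
      (mul_pos ht (Finset.prod_pos fun v _ => h.vertex_pos v)).le, inv_mul_cancel_left₀ ht.ne',
      Real.finsetProd_rpow _ _ fun v _ => (h.vertex_pos v).le]
  refine Hypermatrix.spectralRadius_eq_of_apply_eq (x := fun v : V(H) => x v) (fun i => ?_)
    (fun i => hxpos i) (Real.rpow_nonneg (inv_pos.2 ht).le _) fun i => ?_
  · unfold adjacencyTensor
    positivity
  · rw [adjacencyTensor_apply hH (fun v => (x v : ℂ)) i]
    have key : (∑ e, if (i : α) ∈ edge e then ∏ w ∈ (edge e).erase i, x w else 0) =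
        t⁻¹ ^ (k⁻¹ : ℝ) * x i ^ (k - 1) := by
      -- Multiplied by `x i`, each edge at `i` contributes the product over all its vertices.
      refine mul_right_cancel₀ (hxpos i).ne' ?_
      rw [mul_assoc, ← pow_succ, Nat.sub_add_cancel hk, hxk,
        ← (h.sum_eq i i.2).trans (one_mul _), Finset.mul_sum, Finset.sum_mul]
      refine Finset.sum_congr rfl fun e _ => ?_
      split_ifs with hi
      · rw [Finset.prod_erase_mul _ _ hi, hprod]
      · simp
    have hcast := congrArg (fun z : ℝ => (z : ℂ)) key
    push_cast [apply_ite Complex.ofReal] at hcast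
    exact hcast

/-! ### Labellings and pendent edges -/

section Pendent

variable {α I : Type*} {k : ℕ}

/-- The edges of `attachPendentEdges k H S hS`, where `edge` lists the edges of `H`. -/
def pendentFamily (k : ℕ) (edge : I → Finset α) (S : Set α) :
    I ⊕ S → Finset (α ⊕ α × Fin (k - 1)) :=
  Sum.elim (fun e => (edge e).disjSum ∅) fun s => ({(s : α)} : Finset α).disjSum ({(s : α)} ×ˢ Finset.univ)

theorem IsEdgeFamily.attachPendentEdges (hk : 2 ≤ k) {H : Hypergraph α} {edge : I → Finset α}
    (hH : H.IsEdgeFamily k edge) {S : Set α} (hS : S ⊆ V(H)) :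
    (H.attachPendentEdges k S hS).IsEdgeFamily k (pendentFamily k edge S) := by
  have j₀ : Fin (k - 1) := ⟨0, by omega⟩
  refine ⟨?_, ?_, ?_⟩
  · rintro (e | s) (f | u) h
    · simpa [pendentFamily, hH.injective.eq_iff, -Finset.disjSum_empty] using
        congrArg Finset.toLeft h
    · simpa [pendentFamily] using (Finset.ext_iff.1 h (Sum.inr (u, j₀))).2
    · simpa [pendentFamily] using (Finset.ext_iff.1 h (Sum.inr (s, j₀))).1
    · simpa [pendentFamily, Subtype.ext_iff] using congrArg Finset.toLeft h
  · rintro (e | s)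
    · simp [pendentFamily, hH.card_eq]
    · simp only [pendentFamily, Sum.elim_inr, Finset.card_disjSum, Finset.card_singleton,
        Finset.card_product, Finset.card_univ, Fintype.card_fin]
      omega
  · have hold : ∀ e, ((pendentFamily k edge S (Sum.inl e) : Finset _) : Set (α ⊕ α × Fin (k - 1))) =
        Sum.inl '' (edge e : Set α) := by
      intro e
      ext (v | v) <;> simp [pendentFamily]
    have hnew : ∀ s, ((pendentFamily k edge S (Sum.inr s) : Finset _) : Set (α ⊕ α × Fin (k - 1))) =
        newPendentEdge k (s : α) := by
      intro s
      ext (v | ⟨v, j⟩) <;> simp [pendentFamily, newPendentEdge, eq_comm]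
    ext e
    simp [Hypergraph.attachPendentEdges, hH.edgeSet_eq, hold, hnew]

/-- A pendent edge at `s` and its new vertices carry the label `t * q s`; in exchange the edges of
the original hypergraph at `s` only have to contribute `(1 - t) * q s`. -/
theorem IsConsistentLabelling.attachPendentEdges [DecidableEq α] [Fintype I] (hk : 1 ≤ k)
    {H : Hypergraph α} {edge : I → Finset α} {S : Set α} [DecidablePred (· ∈ S)] [Fintype S] (hS : S ⊆ V(H))
    {t : ℝ} (ht : 0 < t) {q : α → ℝ} {p : I → ℝ}
    (h : IsConsistentLabelling k V(H) edge t (fun v => if v ∈ S then 1 - t else 1) q p) :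
    IsConsistentLabelling k V(H.attachPendentEdges k S hS) (pendentFamily k edge S) t (fun _ => 1)
      (Sum.elim q fun v => t * q v.1) (Sum.elim p fun s => t * q s) := by
  refine ⟨?_, ?_, ?_, ?_⟩
  · rintro (v | v)
    · exact h.vertex_pos v
    · exact mul_pos ht (h.vertex_pos v.1)
  · rintro (e | s)
    · exact h.edge_pos e
    · exact mul_pos ht (h.vertex_pos s)
  · rintro (e | s)
    · simpa [pendentFamily, Finset.prod_disjSum] using h.mul_prod_eq e
    · simp only [pendentFamily, Sum.elim_inr, Finset.prod_disjSum, Finset.prod_singleton,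
        Finset.prod_product, Sum.elim_inl, Finset.prod_const, Finset.card_univ, Fintype.card_fin]
      rw [← mul_assoc, ← pow_succ', Nat.sub_add_cancel hk]
  · rintro (v | ⟨v, j⟩) hv
    · have hvH : v ∈ V(H) := by simpa [Hypergraph.attachPendentEdges] using hv
      have hsum := h.sum_eq v hvH
      simp only [Fintype.sum_sum_type, pendentFamily, Sum.elim_inl, Sum.elim_inr,
        Finset.inl_mem_disjSum, Finset.mem_singleton, hsum]
      split_ifs with hvS
      · rw [Finset.sum_eq_single_of_mem (⟨v, hvS⟩ : S) (Finset.mem_univ _)]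
        · rw [if_pos rfl]
          ring
        · exact fun s _ hs => if_neg fun hvs => hs (Subtype.ext hvs.symm)
      · rw [Finset.sum_eq_zero, add_zero]
        exact fun s _ => if_neg fun hvs : v = s => hvS (hvs ▸ s.2)
    · have hvS : v ∈ S := by
        simpa [Hypergraph.attachPendentEdges] using hv
      simp only [Fintype.sum_sum_type, pendentFamily, Sum.elim_inl, Sum.elim_inr,
        Finset.inr_mem_disjSum, Finset.notMem_empty, if_false, Finset.sum_const_zero, zero_add,
        Finset.mem_product, Finset.mem_singleton, Finset.mem_univ, and_true, one_mul]
      rw [Finset.sum_eq_single_of_mem (⟨v, hvS⟩ : S) (Finset.mem_univ _)]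
      · rw [if_pos rfl]
      · exact fun s _ hs => if_neg fun hvs => hs (Subtype.ext hvs.symm)

end Pendent

/-! ### Labellings of a triangle with a star -/

section TriangleStar

variable {a k : ℕ}

theorem inl_mem_vertexSet_triangleStar (v : Fin 3 ⊕ Fin 3 × Fin (k - 2)) :
    Sum.inl v ∈ V(triangleStar a k) :=
  Or.inl ⟨v, trivial, rfl⟩

theorem inr_some_mem_vertexSet_triangleStar (y : Fin a × Fin (k - 1)) :
    Sum.inr (some y) ∈ V(triangleStar a k) :=
  Or.inr ⟨some y, trivial, by simp [glue]⟩

theorem inr_none_notMem_vertexSet_triangleStar :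
    Sum.inr none ∉ V(triangleStar a k) := by
  rintro (⟨v, -, hv⟩ | ⟨v, -, hv⟩)
  · simp at hv
  · unfold glue at hv
    split_ifs at hv with h
    simp [h] at hv

/-- The edges of `triangleStar a k`: the three edges of the cycle and the `a` edges of the star,
whose center `none` is replaced by the vertex `v₁` of the cycle. -/
def triangleStarFamily (a k : ℕ) :
    Fin 3 ⊕ Fin a → Finset ((Fin 3 ⊕ Fin 3 × Fin (k - 2)) ⊕ Option (Fin a × Fin (k - 1))) :=
  Sum.elim (fun i => (({i, i + 1} : Finset (Fin 3)).disjSum ({i} ×ˢ Finset.univ)).disjSum ∅)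
    fun i =>
      ({Sum.inl 0} : Finset (Fin 3 ⊕ Fin 3 × Fin (k - 2))).disjSum (({i} ×ˢ Finset.univ).map Function.Embedding.some)

theorem isEdgeFamily_triangleStar (hk : 3 ≤ k) :
    (triangleStar a k).IsEdgeFamily k (triangleStarFamily a k) := by
  have j₀ : Fin (k - 1) := ⟨0, by omega⟩
  have l₀ : Fin (k - 2) := ⟨0, by omega⟩
  have hne : ∀ i : Fin 3, i ≠ i + 1 := by decide
  refine ⟨?_, ?_, ?_⟩
  · rintro (i | i) (j | j) h
    · simpa [triangleStarFamily, eq_comm] using Finset.ext_iff.1 h (Sum.inl (Sum.inr (i, l₀)))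
    · simpa [triangleStarFamily] using Finset.ext_iff.1 h (Sum.inr (some (j, j₀)))
    · simpa [triangleStarFamily] using Finset.ext_iff.1 h (Sum.inr (some (i, j₀)))
    · simpa [triangleStarFamily, eq_comm] using Finset.ext_iff.1 h (Sum.inr (some (i, j₀)))
  · rintro (i | i)
    · simp only [triangleStarFamily, Sum.elim_inl, Finset.card_disjSum, Finset.card_empty,
        Finset.card_pair (hne i), Finset.card_product, Finset.card_singleton, Finset.card_univ,
        Fintype.card_fin]
      omega
    · simp only [triangleStarFamily, Sum.elim_inr, Finset.card_disjSum, Finset.card_map,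
        Finset.card_product, Finset.card_singleton, Finset.card_univ, Fintype.card_fin]
      omega
  · have htri : ∀ i, (↑(triangleStarFamily a k (Sum.inl i)) :
        Set ((Fin 3 ⊕ Fin 3 × Fin (k - 2)) ⊕ Option (Fin a × Fin (k - 1)))) =
        Sum.inl '' triangleEdge k i := by
      intro i
      ext ((v | ⟨v, j⟩) | v) <;> simp [triangleStarFamily, triangleEdge, eq_comm]
    have hstar : ∀ i, (↑(triangleStarFamily a k (Sum.inr i)) :
        Set ((Fin 3 ⊕ Fin 3 × Fin (k - 2)) ⊕ Option (Fin a × Fin (k - 1)))) =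
        glue (Sum.inl 0) none '' insert none (Set.range fun j => some (i, j)) := by
      intro i
      rw [Set.image_insert_eq, ← Set.range_comp]
      ext (v | (_ | ⟨v, j⟩)) <;> simp [triangleStarFamily, glue, eq_comm]
    ext e
    simp only [triangleStar, coalesce, Set.mem_union, mem_edgeSet_image, Set.mem_range, Sum.exists,
      htri, hstar]
    simp [triangle, star]

/-- Labels for `triangleStar a k` that are invariant under the symmetry exchanging `v₂` and `v₃`: the
center has label `1`, the vertices `v₂, v₃` have label `b`, the further vertices of `e₁` and `e₃`
have label `c`, those of `e₂` have label `d`, and the leaves of the star have label `l`. The edges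
`e₁, e₃` have label `p₁`, the edge `e₂` has label `p₂`, and the edges of the star have label
`p₃`. -/
theorem isConsistentLabelling_triangleStar
    {t b c d l p₁ p₂ p₃ : ℝ} (hb : 0 < b) (hc : 0 < c) (hd : 0 < d) (hl : 0 < l)
    (hp₁ : 0 < p₁) (hp₂ : 0 < p₂) (hp₃ : 0 < p₃)
    {f : (Fin 3 ⊕ Fin 3 × Fin (k - 2)) ⊕ Option (Fin a × Fin (k - 1)) → ℝ}
    (h₁ : t * (b * c ^ (k - 2)) = p₁ ^ k) (h₂ : t * (b * b * d ^ (k - 2)) = p₂ ^ k)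
    (h₃ : t * l ^ (k - 1) = p₃ ^ k) (hcenter : 2 * p₁ + a * p₃ = f (Sum.inl (Sum.inl 0)))
    (hvertex : ∀ i ≠ 0, p₁ + p₂ = f (Sum.inl (Sum.inl i)) * b)
    (hside : ∀ i ≠ 1, ∀ j, p₁ = f (Sum.inl (Sum.inr (i, j))) * c)
    (hopposite : ∀ j, p₂ = f (Sum.inl (Sum.inr (1, j))) * d)
    (hstar : ∀ y, p₃ = f (Sum.inr (some y)) * l) :
    IsConsistentLabelling k V(triangleStar a k) (triangleStarFamily a k) t f
      (Sum.elim (Sum.elim ![1, b, b] fun v => ![c, d, c] v.1) fun _ => l)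
      (Sum.elim ![p₁, p₂, p₁] fun _ => p₃) := by
  refine ⟨?_, ?_, ?_, ?_⟩
  · rintro ((v | ⟨v, j⟩) | v)
    · fin_cases v <;> simp [hb]
    · fin_cases v <;> simp [hc, hd]
    · exact hl
  · rintro (i | i)
    · fin_cases i <;> simp [hp₁, hp₂]
    · exact hp₃
  · rintro (i | i)
    · have hne : ∀ i : Fin 3, i ≠ i + 1 := by decide
      simp only [triangleStarFamily, Sum.elim_inl, Finset.prod_disjSum,
        Finset.prod_pair (hne i), Finset.prod_product, Finset.prod_singleton, Sum.elim_inr,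
        Finset.prod_const, Finset.card_univ, Fintype.card_fin]
      fin_cases i <;> simp [← h₁, ← h₂]
    · simpa [triangleStarFamily, Finset.prod_disjSum, Finset.prod_product] using h₃
  · rintro ((v | ⟨v, j⟩) | (_ | ⟨i, j⟩)) hv
    · simp only [Fintype.sum_sum_type, triangleStarFamily, Sum.elim_inl, Sum.elim_inr,
        Finset.inl_mem_disjSum, Finset.mem_singleton, Sum.inl.injEq, Fin.sum_univ_three]
      fin_cases v
      · simp [← hcenter]; ring
      · simp [← hvertex 1]
      · simp [← hvertex 2]; ring
    · simp only [Fintype.sum_sum_type, triangleStarFamily, Sum.elim_inl, Sum.elim_inr,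
        Finset.inl_mem_disjSum, Finset.inr_mem_disjSum, Finset.mem_product, Finset.mem_singleton,
        Fin.sum_univ_three]
      fin_cases v
      · simp [← hside 0]
      · simp [← hopposite]
      · simp [← hside 2]
    · exact (inr_none_notMem_vertexSet_triangleStar hv).elim
    · simp [Fintype.sum_sum_type, triangleStarFamily, ← hstar]

end TriangleStar

/-! ### The two spectral radii -/

/-- The labels solve the equations of a labelling of `A` from the leaves of the star and the edge
`e₂` towards the center; `h` is the remaining equation, the one at the center. -/
theorem spectralRadius_hypergraphA {m k : ℕ} (hm : 3 ≤ m) (hk : 3 ≤ k) {s t : ℝ} (hs0 : 0 < s)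
    (hs1 : s < 1) (ht0 : 0 < t) (ht1 : t < 1) (hst : s ^ 2 * (1 - t) ^ k = t)
    (h : s ^ 2 * (m - 3 + 2 / (1 - s)) = 1) :
    (hypergraphA m k).spectralRadius k = t⁻¹ ^ (k⁻¹ : ℝ) := by
  classical
  obtain ⟨r, rfl⟩ : ∃ r, k = r + 2 := ⟨k - 2, by omega⟩
  have hs : 0 < 1 - s := sub_pos.2 hs1
  have ht : 0 < 1 - t := sub_pos.2 ht1
  have hne := hs.ne'
  have hlabel : ∀ x y, s ^ 2 * x = y ^ (r + 2) → t * x = ((1 - t) * y) ^ (r + 2) := by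
    intro x y hxy
    rw [mul_pow, ← hxy]
    linear_combination -x * hst
  obtain ⟨q, p, hbase⟩ : ∃ q p, IsConsistentLabelling (r + 2) V(triangleStar (m - 3) (r + 2))
      (triangleStarFamily (m - 3) (r + 2)) t
      (fun v => if v ∈ V(triangleStar (m - 3) (r + 2)) then 1 - t else 1) q p := by
    refine ⟨_, _, isConsistentLabelling_triangleStar (b := s ^ 2 / (1 - s) ^ 2) (c := s ^ 2 / (1 - s))
      (d := s ^ 3 / (1 - s) ^ 2) (l := s ^ 2) (p₁ := (1 - t) * (s ^ 2 / (1 - s)))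
      (p₂ := (1 - t) * (s ^ 3 / (1 - s) ^ 2)) (p₃ := (1 - t) * s ^ 2) ?_ ?_ ?_ ?_ ?_ ?_ ?_
      ?_ ?_ ?_ ?_ ?_ ?_ ?_ ?_⟩
    any_goals positivity
    · refine hlabel _ _ ?_
      simp only [Nat.add_sub_cancel, pow_add (s ^ 2 / (1 - s)) r 2]
      field_simp
    · refine hlabel _ _ ?_
      simp only [Nat.add_sub_cancel, pow_add (s ^ 3 / (1 - s) ^ 2) r 2, ← mul_assoc]
      field_simp
    · refine hlabel _ _ ?_
      rw [show r + 2 - 1 = r + 1 from rfl]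
      ring
    · rw [if_pos (inl_mem_vertexSet_triangleStar _), Nat.cast_sub hm]
      linear_combination (1 - t) * h
    · intro i _
      rw [if_pos (inl_mem_vertexSet_triangleStar _)]
      field_simp
      ring
    · intro i _ j
      rw [if_pos (inl_mem_vertexSet_triangleStar _)]
    · intro j
      rw [if_pos (inl_mem_vertexSet_triangleStar _)]
    · intro y
      rw [if_pos (inr_some_mem_vertexSet_triangleStar _)]
  exact spectralRadius_eq_of_labelling (by omega)
    ⟨_, Or.inl ⟨_, inl_mem_vertexSet_triangleStar (Sum.inl 0), rfl⟩⟩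
    ((isEdgeFamily_triangleStar hk).attachPendentEdges (by omega) subset_rfl) ht0
    (hbase.attachPendentEdges (by omega) subset_rfl ht0)

/-- As for `A`, but the vertices of `e₂` have no pendent edges. The label parameter of `D` is
`t = τ ^ 2`, as its square root enters the equation at the center. -/
theorem spectralRadius_hypergraphD {m k : ℕ} (hm : 2 ≤ m) (hk : 3 ≤ k) {s τ : ℝ} (hs0 : 0 < s)
    (hτ0 : 0 < τ) (hτ1 : τ < 1) (hst : s ^ 2 * (1 - τ ^ 2) ^ k = τ ^ 2)
    (h : s ^ 2 * (m - 2 + 2 * (1 + τ)) = 1) :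
    (hypergraphD m k).spectralRadius k = (τ ^ 2)⁻¹ ^ (k⁻¹ : ℝ) := by
  classical
  obtain ⟨r, rfl⟩ : ∃ r, k = r + 2 := ⟨k - 2, by omega⟩
  have ht : 0 < 1 - τ ^ 2 := by nlinarith
  have ht0 : 0 < τ ^ 2 := by positivity
  have hlabel : ∀ x y, s ^ 2 * x = y ^ (r + 2) → τ ^ 2 * x = ((1 - τ ^ 2) * y) ^ (r + 2) := by
    intro x y hxy
    rw [mul_pow, ← hxy]
    linear_combination -x * hst
  set S := V(triangleStar (m - 2) (r + 2)) \ Sum.inl '' triangleEdge (r + 2) 1 with hS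
  have hcenter : Sum.inl (Sum.inl 0) ∈ S :=
    ⟨inl_mem_vertexSet_triangleStar _, by simp [triangleEdge]⟩
  have hvertex : ∀ i ≠ 0, Sum.inl (Sum.inl i) ∉ S := by
    intro i hi hiS
    refine hiS.2 ⟨_, ?_, rfl⟩
    fin_cases i
    · simp at hi
    all_goals simp [triangleEdge]
  have hside : ∀ i ≠ 1, ∀ j, Sum.inl (Sum.inr (i, j)) ∈ S := fun i hi j =>
    ⟨inl_mem_vertexSet_triangleStar _, by simpa [triangleEdge, eq_comm] using hi⟩
  have hopposite : ∀ j, Sum.inl (Sum.inr (1, j)) ∉ S := fun j hj =>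
    hj.2 ⟨_, by simp [triangleEdge], rfl⟩
  have hstar : ∀ y, Sum.inr (some y) ∈ S := fun y =>
    ⟨inr_some_mem_vertexSet_triangleStar _, by simp⟩
  obtain ⟨q, p, hbase⟩ : ∃ q p, IsConsistentLabelling (r + 2) V(triangleStar (m - 2) (r + 2))
      (triangleStarFamily (m - 2) (r + 2)) (τ ^ 2) (fun v => if v ∈ S then 1 - τ ^ 2 else 1)
      q p := by
    refine ⟨_, _, isConsistentLabelling_triangleStar (b := s ^ 2 * (1 + τ) ^ 2) (c := s ^ 2 * (1 + τ))
      (d := τ * (s ^ 2 * (1 + τ) ^ 2)) (l := s ^ 2) (p₁ := (1 - τ ^ 2) * (s ^ 2 * (1 + τ)))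
      (p₂ := τ * (s ^ 2 * (1 + τ) ^ 2)) (p₃ := (1 - τ ^ 2) * s ^ 2) ?_ ?_ ?_ ?_ ?_ ?_ ?_
      ?_ ?_ ?_ ?_ ?_ ?_ ?_ ?_⟩
    any_goals positivity
    · refine hlabel _ _ ?_
      simp only [Nat.add_sub_cancel, pow_add (s ^ 2 * (1 + τ)) r 2]
      ring
    · simp only [Nat.add_sub_cancel, pow_add (τ * (s ^ 2 * (1 + τ) ^ 2)) r 2]
      ring
    · refine hlabel _ _ ?_
      rw [show r + 2 - 1 = r + 1 from rfl]
      ring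
    · rw [if_pos hcenter, Nat.cast_sub hm]
      push_cast
      linear_combination (1 - τ ^ 2) * h
    · intro i hi
      rw [if_neg (hvertex i hi)]
      ring
    · intro i hi j
      rw [if_pos (hside i hi j)]
    · intro j
      rw [if_neg (hopposite j), one_mul]
    · intro y
      rw [if_pos (hstar y)]
  exact spectralRadius_eq_of_labelling (by omega)
    ⟨_, Or.inl ⟨_, inl_mem_vertexSet_triangleStar (Sum.inl 0), rfl⟩⟩
    ((isEdgeFamily_triangleStar hk).attachPendentEdges (by omega) Set.sdiff_subset) ht0
    (hbase.attachPendentEdges (by omega) Set.sdiff_subset ht0)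

/-! ### Comparison of the equations at the center -/

/-- The bound `s ≤ 1 / 3` is where `9 ≤ m` enters: at `s = 1 / 3` the left-hand side is `m / 9`. -/
theorem exists_hypergraphA_parameter {m : ℕ} (hm : 9 ≤ m) :
    ∃ s : ℝ, 0 < s ∧ s ≤ 1 / 3 ∧ s ^ 2 * (m - 3 + 2 / (1 - s)) = 1 := by
  have hm' : (9 : ℝ) ≤ m := by exact_mod_cast hm
  have hcont : ContinuousOn (fun s : ℝ => s ^ 2 * (m - 3 + 2 / (1 - s))) (Set.Icc 0 (1 / 3)) := by
    refine (continuousOn_pow 2).mul (continuousOn_const.add (continuousOn_const.div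
      (continuousOn_const.sub continuousOn_id) fun s hs => ?_))
    have : s ≤ 1 / 3 := hs.2
    exact (by linarith : (0 : ℝ) < 1 - s).ne'
  obtain ⟨s, hs, h⟩ := intermediate_value_Icc (by norm_num) hcont
    (show (1 : ℝ) ∈ Set.Icc _ _ from ⟨by norm_num, by norm_num; linarith⟩)
  refine ⟨s, hs.1.lt_of_ne ?_, hs.2, h⟩
  rintro rfl
  norm_num at h

theorem exists_mul_one_sub_sq_pow_eq {k : ℕ} (hk : 1 ≤ k) {s : ℝ} (hs0 : 0 < s) :
    ∃ τ : ℝ, 0 < τ ∧ τ < 1 ∧ s ^ 2 * (1 - τ ^ 2) ^ k = τ ^ 2 := by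
  have hcont : ContinuousOn (fun τ : ℝ => τ ^ 2 - s ^ 2 * (1 - τ ^ 2) ^ k) (Set.Icc 0 1) := by
    fun_prop
  have hk0 : k ≠ 0 := by omega
  obtain ⟨τ, hτ, h⟩ := intermediate_value_Ioo (by norm_num) hcont
    (show (0 : ℝ) ∈ Set.Ioo _ _ from ⟨by simpa using pow_pos hs0 2, by simp [hk0]⟩)
  exact ⟨τ, hτ.1, hτ.2, (sub_eq_zero.1 h).symm⟩

/-- If the left-hand side of the center equation of `D` exceeds `1` at `σ`, then that equation has a
solution `τ < σ`, as its left-hand side vanishes at `0`. -/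
theorem exists_hypergraphD_parameter {m k : ℕ} {s σ : ℝ} (hσ0 : 0 < σ)
    (hσ1 : σ < 1) (hs : s ^ 2 * (1 - σ ^ 2) ^ k = σ ^ 2) (h : 1 < s ^ 2 * (m - 2 + 2 * (1 + σ))) :
    ∃ u τ : ℝ, 0 < u ∧ 0 < τ ∧ τ < σ ∧ u ^ 2 * (1 - τ ^ 2) ^ k = τ ^ 2 ∧
      u ^ 2 * (m - 2 + 2 * (1 + τ)) = 1 := by
  have hpos : ∀ τ : ℝ, 0 ≤ τ → τ ≤ σ → 0 < 1 - τ ^ 2 := fun τ h0 h1 => by nlinarith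
  have hcont : ContinuousOn
      (fun τ : ℝ => τ ^ 2 / (1 - τ ^ 2) ^ k * (m - 2 + 2 * (1 + τ))) (Set.Icc 0 σ) := by
    refine ContinuousOn.mul (ContinuousOn.div (by fun_prop) (by fun_prop) fun τ hτ => ?_)
      (by fun_prop)
    exact (pow_pos (hpos τ hτ.1 hτ.2) k).ne'
  have hσ : σ ^ 2 / (1 - σ ^ 2) ^ k = s ^ 2 :=
    (div_eq_iff (pow_pos (hpos σ hσ0.le le_rfl) k).ne').2 hs.symm
  obtain ⟨τ, hτ, hτeq⟩ := intermediate_value_Ioo hσ0.le hcont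
    (show (1 : ℝ) ∈ Set.Ioo _ _ from ⟨by simp, by simpa only [hσ] using h⟩)
  have hden : 0 < (1 - τ ^ 2) ^ k := pow_pos (hpos τ hτ.1.le hτ.2.le) k
  have hquot : 0 < τ ^ 2 / (1 - τ ^ 2) ^ k := div_pos (pow_pos hτ.1 2) hden
  refine ⟨√(τ ^ 2 / (1 - τ ^ 2) ^ k), τ, Real.sqrt_pos.2 hquot, hτ.1, hτ.2, ?_, ?_⟩
  · rw [Real.sq_sqrt hquot.le, div_mul_cancel₀ _ hden.ne']
  · rw [Real.sq_sqrt hquot.le]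
    exact hτeq

end Hypergraph

theorem lemma3p9 (m k : ℕ) (hm : 9 ≤ m) (hk : 3 ≤ k) :
    (Hypergraph.hypergraphD m k).spectralRadius k >
      (Hypergraph.hypergraphA m k).spectralRadius k := by
  obtain ⟨s, hs0, hs3, hs⟩ := Hypergraph.exists_hypergraphA_parameter hm
  have hs1 : s < 1 := by linarith
  obtain ⟨σ, hσ0, hσ1, hσ⟩ :=
    Hypergraph.exists_mul_one_sub_sq_pow_eq (k := k) (by omega) hs0
  -- At the parameter of `A`, the left-hand side for `D` exceeds the one for `A` by
  -- `s ^ 2 * (3 + 2 * σ - 2 / (1 - s)) > 0`.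
  have hlt : 1 < s ^ 2 * (m - 2 + 2 * (1 + σ)) := by
    have h3 : 2 / (1 - s) ≤ 3 := by
      rw [div_le_iff₀ (by linarith)]
      linarith
    rw [← hs]
    exact mul_lt_mul_of_pos_left (by linarith) (pow_pos hs0 2)
  obtain ⟨u, τ, hu0, hτ0, hτσ, hτ, hu⟩ :=
    Hypergraph.exists_hypergraphD_parameter hσ0 hσ1 hσ hlt
  rw [Hypergraph.spectralRadius_hypergraphA (by omega) hk hs0 hs1 (pow_pos hσ0 2) (by nlinarith)
      hσ hs,
    Hypergraph.spectralRadius_hypergraphD (by omega) hk hu0 hτ0 (hτσ.trans hσ1) hτ hu]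
  have hk0 : (0 : ℝ) < (k : ℝ)⁻¹ := inv_pos.2 (by exact_mod_cast (by omega : 0 < k))
  refine Real.rpow_lt_rpow (by positivity) ?_ hk0
  exact inv_strictAnti₀ (pow_pos hτ0 2) (pow_lt_pow_left₀ hτσ hτ0.le two_ne_zero)
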